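/- Let $\mathrm{SmCat}$ be the category of small categories and functors, with the Joyal–Tierney (canonical) model structure: the cofibrations are the functors that are injective on objects, the weak equivalences are the equivalences of categories, and the fibrations are the functors with the right lifting property against all acyclic cofibrations (equivalently, the isofibrations). Write $1$ for the terminal category. Definitions. - An object $W$ is a homotopy pushout of $Z\xleftarrow{f}X\xrightarrow{g}Y$ if there are acyclic fibrations $\tilde X\to X$, $\tilde Y\to Y$, $\tilde Z\to Z$ with $\tilde X$ cofibrant, and cofibrations $\tilde X\to\tilde Z$, $\tilde X\to\tilde Y$ lying over $f$ and $g$, such that $W$ is a pushout of $\tilde Z\leftarrow\tilde X\to\tilde Y$. - For $X$ cofibrant, $W$ is a one-sided homotopy pushout of $f:X\to Z$ along $g:X\to Y$ if $g$ factors as a cofibration $X\to\tilde Y$ followed by an acyclic fibration $\tilde Y\to Y$ such that $W$ is a pushout of $Z\xleftarrow{f}X\to\tilde Y$. - The $0$-sphere is $1\amalg 1$ (up to isomorphism). For $n\ge 1$, an $n$-sphere is a homotopy pushout of $1\leftarrow S\to 1$ with $S$ an $(n-1)$-sphere. - A $0$-dimensional CW-complex is a cofibrant object that is a coproduct of copies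 of $1$. For $n\ge1$, an $n$-dimensional CW-complex is a one-sided homotopy pushout of a map $\coprod_{i\in I}S_i\to Y$ along the canonical map $\coprod_{i\in I}S_i\to\coprod_{i\in I}1$, where $I$ is a set, each $S_i$ is an $(n-1)$-sphere and $Y$ is an $(n-1)$-dimensional CW-complex. Theorem. For every small category $\mathcal{X}$, the following are equivalent: 1. $\mathcal{X}$ is a $2$-dimensional CW-complex in $\mathrm{SmCat}$; 2. $\mathcal{X}$ is weakly equivalent (connected by a finite zigzag of weak equivalences) to a $2$-dimensional CW-complex in $\mathrm{SmCat}$; 3. $\mathcal{X}$ is a groupoid. -/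

import Mathlib

universe v u

open CategoryTheory Limits HomotopicalAlgebra

namespace FormalCW

section General

/-! Spheres and CW-complexes in a category with cofibrations, fibrations and weak equivalences. -/

variable {C : Type u} [Category.{v} C]
  [CategoryWithCofibrations C] [CategoryWithFibrations C] [CategoryWithWeakEquivalences C]

/-- `W` is a homotopy pushout of the span `Z ← X → Y` with legs `f` and `g`: the span is replaced,
along acyclic fibrations, by a span of cofibrations out of a cofibrant object, and `W` is a pushout
of the replacement. -/
def IsHomotopyPushout [HasInitial C] {X Y Z : C} (f : X ⟶ Z) (g : X ⟶ Y) (W : C) : Prop :=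
  ∃ (X' Y' Z' : C) (f' : X' ⟶ Z') (g' : X' ⟶ Y') (inl : Z' ⟶ W) (inr : Y' ⟶ W)
    (pX : X' ⟶ X) (pY : Y' ⟶ Y) (pZ : Z' ⟶ Z),
    IsCofibrant X' ∧ Cofibration f' ∧ Cofibration g' ∧
    trivialFibrations C pX ∧ trivialFibrations C pY ∧ trivialFibrations C pZ ∧
    f' ≫ pZ = pX ≫ f ∧ g' ≫ pY = pX ≫ g ∧
    IsPushout f' g' inl inr

/-- `W` is a one-sided homotopy pushout of `f : X ⟶ Z` along `g : X ⟶ Y`, with `X` cofibrant: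
only `g` is replaced by a cofibration `g' : X ⟶ Y'`, where `g` is `g'` followed by an acyclic
fibration. -/
def IsOneSidedHomotopyPushout [HasInitial C] {X Y Z : C} (f : X ⟶ Z) (g : X ⟶ Y) (W : C) : Prop :=
  IsCofibrant X ∧
  ∃ (Y' : C) (g' : X ⟶ Y') (p : Y' ⟶ Y) (inl : Z ⟶ W) (inr : Y' ⟶ W),
    Cofibration g' ∧ trivialFibrations C p ∧ g' ≫ p = g ∧ IsPushout f g' inl inr

/-- `IsSphere n X`: the object `X` is an `n`-sphere. -/
def IsSphere [HasInitial C] [HasTerminal C] [HasBinaryCoproducts C] : ℕ → C → Prop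
  | 0, X => Nonempty (X ≅ (⊤_ C) ⨿ (⊤_ C))
  | n + 1, X => ∃ Y : C, IsSphere n Y ∧
      IsHomotopyPushout (terminal.from Y) (terminal.from Y) X

/-- `IsCWComplex n X`: the object `X` is an `n`-dimensional CW-complex. -/
def IsCWComplex [HasInitial C] [HasTerminal C] [HasBinaryCoproducts C] [HasCoproducts.{v} C] :
    ℕ → C → Prop
  | 0, X => IsCofibrant X ∧ ∃ I : Type v, Nonempty (X ≅ ∐ fun _ : I => ⊤_ C)
  | n + 1, X => ∃ (I : Type v) (S : I → C) (Y : C) (f : ∐ S ⟶ Y),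
      (∀ i, IsSphere n (S i)) ∧ IsCWComplex n Y ∧
      IsOneSidedHomotopyPushout f
        (Limits.Sigma.map fun i => terminal.from (S i) : ∐ S ⟶ ∐ fun _ : I => ⊤_ C) X

/-- Two objects are weakly equivalent if a finite zigzag of weak equivalences connects them. -/
def WeaklyEquivalent (X Y : C) : Prop :=
  Relation.EqvGen (fun A B : C => ∃ f : A ⟶ B, WeakEquivalence f) X Y

end General

section JoyalTierney

/-! The three classes of the Joyal–Tierney model structure on small categories. -/

/-- Cofibrations: the functors that are injective on objects. -/
instance : CategoryWithCofibrations Cat.{v, u} where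
  cofibrations _ _ F := Function.Injective F.toFunctor.obj

/-- Weak equivalences: the equivalences of categories. -/
instance : CategoryWithWeakEquivalences Cat.{v, u} where
  weakEquivalences _ _ F := F.toFunctor.IsEquivalence

/-- Fibrations: the functors with the right lifting property against all acyclic cofibrations. -/
instance : CategoryWithFibrations Cat.{v, u} where
  fibrations := (trivialCofibrations Cat.{v, u}).rlp

end JoyalTierney

end FormalCW

/-!
Coproducts and pushouts of groupoids in `Cat` are groupoids: a colimit of groupoids retracts onto
itself through its core, because every leg of the colimit cocone factors through the core.

Conversely a groupoid `X` is recovered from its set of objects by two steps of the small object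
argument. Attaching cells along `S⁰ → I` to the discrete category on its objects yields a groupoid
with a functor `q` to `X` which is bijective on objects and full, since every arrow of `X` is an
isomorphism. Cells along `S¹ → I` over `q` are pairs of parallel arrows with the same image, and
attaching them divides out the kernel of `q`; the result is `X` itself.
-/

namespace FormalCW

section Groupoids

lemma isGroupoid_iff_of_isEquivalence {A B : Type*} [Category* A] [Category* B] (F : A ⥤ B)
    [F.IsEquivalence] : IsGroupoid A ↔ IsGroupoid B :=
  ⟨fun _ => isGroupoid_of_reflects_iso F.inv, fun _ => isGroupoid_of_reflects_iso F⟩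

lemma isEquivalence_of_isIso {A B : Cat.{v, u}} (F : A ⟶ B) [IsIso F] :
    F.toFunctor.IsEquivalence :=
  (Cat.equivOfIso (asIso F)).isEquivalence_functor

lemma isGroupoid_iff_of_iso {A B : Cat.{v, u}} (e : A ≅ B) : IsGroupoid A ↔ IsGroupoid B :=
  have := isEquivalence_of_isIso e.hom
  isGroupoid_iff_of_isEquivalence e.hom.toFunctor

lemma isGroupoid_of_comp_eq_id {A B : Type*} [Category* A] [Category* B] [IsGroupoid B]
    {F : A ⥤ B} {G : B ⥤ A} (h : F ⋙ G = 𝟭 A) : IsGroupoid A :=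
  have : (F ⋙ G).ReflectsIsomorphisms := h ▸ inferInstance
  have := reflectsIsomorphisms_of_comp F G
  isGroupoid_of_reflects_iso F

/-- The corestriction of a functor out of a groupoid to the core of its target. -/
noncomputable def toCore {A T : Cat.{v, u}} [IsGroupoid A] (F : A ⟶ T) : A ⟶ Cat.of (Core T) :=
  letI := Groupoid.ofIsGroupoid (C := A)
  (Core.functorToCore F.toFunctor).toCatHom

lemma toCore_comp_inclusion {A T : Cat.{v, u}} [IsGroupoid A] (F : A ⟶ T) :
    toCore F ≫ (Core.inclusion T).toCatHom = F := rfl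

lemma comp_toCore {A B T : Cat.{v, u}} [IsGroupoid A] [IsGroupoid B] (F : A ⟶ B) (G : B ⟶ T) :
    F ≫ toCore G = toCore (F ≫ G) := by
  refine Cat.Hom.ext (Functor.hext (fun _ => rfl) fun x y f => heq_of_eq ?_)
  exact Core.hom_ext rfl

lemma isGroupoid_of_isColimit {J : Type*} [Category* J] {F : J ⥤ Cat.{v, u}} {c : Cocone F}
    (hc : IsColimit c) (h : ∀ j, IsGroupoid (F.obj j)) : IsGroupoid c.pt := by
  let s : Cocone F :=
    { pt := Cat.of (Core c.pt)
      ι :=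
        { app j := toCore (c.ι.app j)
          naturality i j f := by simp [comp_toCore] } }
  have retraction : hc.desc s ≫ (Core.inclusion c.pt).toCatHom = 𝟙 c.pt :=
    hc.hom_ext fun j => by
      rw [hc.fac_assoc]
      exact toCore_comp_inclusion (c.ι.app j)
  have : IsGroupoid s.pt := inferInstanceAs (IsGroupoid (Core c.pt))
  exact isGroupoid_of_comp_eq_id (congrArg Cat.Hom.toFunctor retraction)

lemma isGroupoid_of_isPushout {A B C W : Cat.{v, u}} {f : A ⟶ B} {g : A ⟶ C}
    {inl : B ⟶ W} {inr : C ⟶ W} (sq : IsPushout f g inl inr)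
    (hA : IsGroupoid A) (hB : IsGroupoid B) (hC : IsGroupoid C) : IsGroupoid W :=
  isGroupoid_of_isColimit sq.isColimit (by rintro (_ | _ | _) <;> assumption)

lemma isGroupoid_sigma {I : Type*} {S : I → Cat.{v, u}} [HasCoproduct S]
    (h : ∀ i, IsGroupoid (S i)) : IsGroupoid (∐ S : Cat.{v, u}) :=
  isGroupoid_of_isColimit (coproductIsCoproduct S) fun ⟨i⟩ => h i

end Groupoids

section Objects

lemma hom_ext_of_isDiscrete {A B : Cat.{v, u}} [IsDiscrete A] {F G : A ⟶ B}
    (h : ∀ x, F.toFunctor.obj x = G.toFunctor.obj x) : F = G := by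
  refine Cat.Hom.ext (CategoryTheory.Functor.ext h fun x y f => ?_)
  obtain rfl := IsDiscrete.eq_of_hom f
  obtain rfl : f = 𝟙 x := Subsingleton.elim _ _
  simp

/-- The category with a unique arrow between any two elements of a type. It is right adjoint to
`Cat.objects`; `Codiscrete.functorToCat` is its instance for `v = 0`. -/
def codiscrete : Type u ⥤ Cat.{v, u} where
  obj A := Cat.of (ULiftHom.{v} (Codiscrete A))
  map f := (ULiftHom.down ⋙ Codiscrete.functorOfFun f ⋙ ULiftHom.up).toCatHom

/-- The adjunction between objects and codiscrete categories. -/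
def objectsAdjCodiscrete : Cat.objects.{v, u} ⊣ codiscrete :=
  Adjunction.mkOfHomEquiv
    { homEquiv _ _ :=
        { toFun f := (Codiscrete.functor f ⋙ ULiftHom.up).toCatHom
          invFun F := ↾fun x => (ULiftHom.objDown.{u, v} (F.toFunctor.obj x)).as
          left_inv _ := rfl
          right_inv _ := rfl }
      homEquiv_naturality_left_symm _ _ := rfl
      homEquiv_naturality_right _ _ := rfl }

instance : Cat.objects.{v, u}.IsLeftAdjoint := objectsAdjCodiscrete.isLeftAdjoint

lemma obj_bijective_of_isIso {A B : Cat.{v, u}} (F : A ⟶ B) [IsIso F] :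
    Function.Bijective F.toFunctor.obj :=
  (isIso_iff_bijective (Cat.objects.map F)).1 inferInstance

lemma obj_surjective_of_isPushout {A B C W : Cat.{v, u}} {f : A ⟶ B} {g : A ⟶ C}
    {inl : B ⟶ W} {inr : C ⟶ W} (sq : IsPushout f g inl inr)
    (hg : Function.Surjective g.toFunctor.obj) : Function.Surjective inl.toFunctor.obj := by
  have : Epi (Cat.objects.map g) := (epi_iff_surjective _).2 hg
  have : Epi (Cat.objects.map inl) := (MorphismProperty.epimorphisms _).of_isPushout
    (sq.map Cat.objects) (MorphismProperty.epimorphisms.infer_property (Cat.objects.map g))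
  exact (epi_iff_surjective _).1 this

end Objects

section Discrete

instance : typeToCat.{u}.IsLeftAdjoint := Cat.typeToCatObjectsAdj.isLeftAdjoint

/-- The terminal category as a discrete category. -/
noncomputable def discretePUnitIso : Cat.of (Discrete PUnit.{u + 1}) ≅ ⊤_ Cat.{u, u} :=
  Cat.terminalIsoOfUniqueOfIsDiscrete.symm

/-- A discrete category is a coproduct of terminal categories. -/
noncomputable def discreteIsoCoproduct (I : Type u) :
    Cat.of (Discrete I) ≅ ∐ fun _ : I => ⊤_ Cat.{u, u} :=
  typeToCat.mapIso ((Equiv.sigmaUnique I fun _ => PUnit.{u + 1}).symm.toIso ≪≫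
      (Types.coproductIso fun _ : I => PUnit).symm) ≪≫
    PreservesCoproduct.iso typeToCat (fun _ : I => PUnit) ≪≫
    Limits.Sigma.mapIso fun _ => discretePUnitIso

/-- The discrete category on a two-element type is the standard `0`-sphere. -/
noncomputable def discreteIsoCoprod {A : Type u} (e : A ≃ Bool) :
    Cat.of (Discrete A) ≅ (⊤_ Cat.{u, u}) ⨿ ⊤_ Cat :=
  typeToCat.mapIso ((e.trans Equiv.boolEquivPUnitSumPUnit).toIso ≪≫
      (Types.binaryCoproductIso PUnit.{u + 1} PUnit).symm) ≪≫
    (PreservesColimitPair.iso typeToCat PUnit.{u + 1} PUnit.{u + 1}).symm ≪≫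
    coprod.mapIso discretePUnitIso discretePUnitIso

instance : Subsingleton (⊤_ Cat.{u, u} : Cat.{u, u}) :=
  have : Subsingleton (Cat.of (Discrete PUnit.{u + 1})) :=
    inferInstanceAs (Subsingleton (Discrete PUnit))
  (obj_bijective_of_isIso discretePUnitIso.inv).1.subsingleton

instance (x y : (⊤_ Cat.{u, u} : Cat.{u, u})) : Subsingleton (x ⟶ y) :=
  have := isEquivalence_of_isIso discretePUnitIso.{u}.inv
  have (a b : Cat.of (Discrete PUnit.{u + 1})) : Subsingleton (a ⟶ b) :=
    Discrete.instSubsingletonDiscreteHom a b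
  (discretePUnitIso.inv.toFunctor.map_injective (X := x) (Y := y)).subsingleton

/-- The functor to a category from the discrete category on its objects. -/
def vertices (X : Cat.{u, u}) : Cat.of (Discrete X) ⟶ X := (Discrete.functor id).toCatHom

lemma vertices_bijective (X : Cat.{u, u}) : Function.Bijective (vertices X).toFunctor.obj :=
  (discreteEquiv (α := X)).bijective

lemma vertices_comp_eq_iff {X T : Cat.{u, u}} {F G : X ⟶ T} :
    vertices X ≫ F = vertices X ≫ G ↔ F.toFunctor.obj = G.toFunctor.obj :=
  ⟨fun h => funext fun x => congrArg (fun K => K.toFunctor.obj ⟨x⟩) h,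
    fun h => have : IsDiscrete (Cat.of (Discrete X)) := Discrete.isDiscrete X
      hom_ext_of_isDiscrete fun x => congrFun h x.as⟩

end Discrete

section Coproducts

section

variable {I : Type*} {C D : I → Type u} [∀ i, Category.{v} (C i)] [∀ i, Category.{v} (D i)]
  (F : ∀ i, C i ⥤ D i)

instance [∀ i, (F i).Faithful] : (Sigma.Functor.sigma F).Faithful where
  map_injective := by
    rintro ⟨i, x⟩ ⟨_, y⟩ ⟨f⟩ ⟨g⟩ h
    exact congrArg Sigma.SigmaHom.mk ((F i).map_injective ((Sigma.incl i).map_injective h))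

instance [∀ i, (F i).Full] : (Sigma.Functor.sigma F).Full where
  map_surjective := by
    rintro ⟨i, x⟩ ⟨j, y⟩ f
    obtain ⟨f⟩ : Sigma.SigmaHom (C := D) ⟨i, (F i).obj x⟩ ⟨j, (F j).obj y⟩ := f
    exact ⟨Sigma.SigmaHom.mk ((F i).preimage f),
      congrArg Sigma.SigmaHom.mk ((F i).map_preimage f)⟩

instance [∀ i, (F i).EssSurj] : (Sigma.Functor.sigma F).EssSurj where
  mem_essImage := by
    rintro ⟨i, y⟩
    exact ⟨⟨i, (F i).objPreimage y⟩, ⟨(Sigma.incl i).mapIso ((F i).objObjPreimageIso y)⟩⟩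

instance [∀ i, (F i).IsEquivalence] : (Sigma.Functor.sigma F).IsEquivalence where

end

variable {I : Type u}

/-- The disjoint union of a family of categories, as a cofan. -/
abbrev sigmaCofan (S : I → Cat.{u, u}) : Cofan S :=
  Cofan.mk (Cat.of (Σ i, S i)) fun i => (Sigma.incl (C := fun i => S i) i).toCatHom

/-- The disjoint union is the coproduct in the category of categories. -/
def sigmaCofanIsColimit (S : I → Cat.{u, u}) : IsColimit (sigmaCofan S) :=
  Cofan.IsColimit.mk _ (fun s => (Sigma.desc fun i => (s.inj i).toFunctor).toCatHom)
    (fun _ _ => rfl)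
    (fun s m h => by
      refine Cat.Hom.ext (CategoryTheory.Functor.ext ?_ ?_)
      · rintro ⟨i, x⟩
        exact congrArg (fun F => F.toFunctor.obj x) (h i)
      · rintro ⟨i, x⟩ ⟨_, y⟩ ⟨f⟩
        exact Functor.congr_hom (congrArg Cat.Hom.toFunctor (h i)) f)

/-- The chosen coproduct of a family of categories is their disjoint union. -/
noncomputable def sigmaIso (S : I → Cat.{u, u}) : ∐ S ≅ Cat.of (Σ i, S i) :=
  (coproductIsCoproduct S).coconePointUniqueUpToIso (sigmaCofanIsColimit S)

variable {S T : I → Cat.{u, u}} (F : ∀ i, S i ⟶ T i)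

lemma sigma_map_eq : Limits.Sigma.map F = (sigmaIso S).hom ≫
    (Sigma.Functor.sigma fun i => (F i).toFunctor).toCatHom ≫ (sigmaIso T).inv := by
  have ι_sigmaIso_hom (S : I → Cat.{u, u}) (i : I) :
      Limits.Sigma.ι S i ≫ (sigmaIso S).hom = (Sigma.incl (C := fun i => S i) i).toCatHom :=
    (coproductIsCoproduct S).comp_coconePointUniqueUpToIso_hom (sigmaCofanIsColimit S) ⟨i⟩
  rw [← Category.assoc, Iso.eq_comp_inv]
  refine Limits.Sigma.hom_ext _ _ fun i => ?_
  rw [Limits.Sigma.ι_map_assoc, ι_sigmaIso_hom, reassoc_of% ι_sigmaIso_hom]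
  rfl

lemma sigma_map_obj_injective (h : ∀ i, Function.Injective (F i).toFunctor.obj) :
    Function.Injective (Limits.Sigma.map F).toFunctor.obj := by
  rw [sigma_map_eq]
  refine ((obj_bijective_of_isIso (sigmaIso T).inv).1.comp ?_).comp
    (obj_bijective_of_isIso (sigmaIso S).hom).1
  exact Function.injective_id.sigma_map (β₁ := fun i => S i)
    (β₂ := fun i => T i) (f₂ := fun i => (F i).toFunctor.obj) h

lemma sigma_map_obj_surjective (h : ∀ i, Function.Surjective (F i).toFunctor.obj) :
    Function.Surjective (Limits.Sigma.map F).toFunctor.obj := by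
  rw [sigma_map_eq]
  refine ((obj_bijective_of_isIso (sigmaIso T).inv).2.comp ?_).comp
    (obj_bijective_of_isIso (sigmaIso S).hom).2
  exact Function.surjective_id.sigma_map (β₁ := fun i => S i)
    (β₂ := fun i => T i) (f₂ := fun i => (F i).toFunctor.obj) h

instance [∀ i, (F i).toFunctor.IsEquivalence] :
    (Limits.Sigma.map F).toFunctor.IsEquivalence := by
  rw [sigma_map_eq]
  have := isEquivalence_of_isIso (sigmaIso S).hom
  have := isEquivalence_of_isIso (sigmaIso T).inv
  have : (Sigma.Functor.sigma fun i => (F i).toFunctor).toCatHom.toFunctor.IsEquivalence :=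
    inferInstanceAs (Sigma.Functor.sigma fun i => (F i).toFunctor).IsEquivalence
  exact inferInstanceAs ((sigmaIso S).hom.toFunctor ⋙
    (Sigma.Functor.sigma fun i => (F i).toFunctor).toCatHom.toFunctor ⋙
      (sigmaIso T).inv.toFunctor).IsEquivalence

end Coproducts

section TrivialFibrations

/-- A functor into the source of a fully faithful functor `p`, given by a lift on objects of a
functor into the target of `p`. -/
noncomputable def liftOfObj {B E D : Cat.{v, u}} (p : E ⟶ D) [p.toFunctor.Full]
    [p.toFunctor.Faithful] (b : B ⟶ D) (φ : B → E)
    (h : ∀ x, p.toFunctor.obj (φ x) = b.toFunctor.obj x) : B ⟶ E :=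
  Functor.toCatHom
    { obj := φ
      map {x y} f := p.toFunctor.preimage
        (eqToHom (h x) ≫ b.toFunctor.map f ≫ eqToHom (h y).symm)
      map_id x := p.toFunctor.map_injective (by simp)
      map_comp f g := p.toFunctor.map_injective (by simp) }

lemma liftOfObj_comp {B E D : Cat.{v, u}} (p : E ⟶ D) [p.toFunctor.Full]
    [p.toFunctor.Faithful] (b : B ⟶ D) (φ : B → E)
    (h : ∀ x, p.toFunctor.obj (φ x) = b.toFunctor.obj x) : liftOfObj p b φ h ≫ p = b :=
  Cat.Hom.ext (CategoryTheory.Functor.ext h fun _ _ _ => p.toFunctor.map_preimage _)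

lemma hom_ext_of_comp_faithful {A E D : Cat.{v, u}} (p : E ⟶ D) [p.toFunctor.Faithful]
    {F G : A ⟶ E} (hobj : ∀ x, F.toFunctor.obj x = G.toFunctor.obj x) (h : F ≫ p = G ≫ p) :
    F = G := by
  refine Cat.Hom.ext (CategoryTheory.Functor.ext hobj fun x y f => p.toFunctor.map_injective ?_)
  simpa [eqToHom_map] using Functor.congr_hom (congrArg Cat.Hom.toFunctor h) f

lemma hasLiftingProperty {A B E D : Cat.{v, u}} {i : A ⟶ B} {p : E ⟶ D}
    (hi : Function.Injective i.toFunctor.obj) [p.toFunctor.Full] [p.toFunctor.Faithful]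
    (hp : Function.Surjective p.toFunctor.obj) : HasLiftingProperty i p where
  sq_hasLift {a b} sq := by
    let φ : B → E := Function.extend i.toFunctor.obj a.toFunctor.obj
      (Function.surjInv hp ∘ b.toFunctor.obj)
    have φ_obj (y : A) : φ (i.toFunctor.obj y) = a.toFunctor.obj y := hi.extend_apply _ _ y
    have obj_φ (x : B) : p.toFunctor.obj (φ x) = b.toFunctor.obj x := by
      by_cases hx : ∃ y, i.toFunctor.obj y = x
      · obtain ⟨y, rfl⟩ := hx
        rw [φ_obj]
        exact congrArg (fun F => F.toFunctor.obj y) sq.w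
      · rw [show φ x = _ from Function.extend_apply' _ _ x hx]
        exact Function.surjInv_eq hp _
    refine ⟨⟨liftOfObj p b φ obj_φ, hom_ext_of_comp_faithful p φ_obj ?_,
      liftOfObj_comp p b φ obj_φ⟩⟩
    rw [Category.assoc, liftOfObj_comp, sq.w]

lemma isIso_of_obj_bijective {A B : Cat.{v, u}} (p : A ⟶ B) [p.toFunctor.Full]
    [p.toFunctor.Faithful] (hp : Function.Bijective p.toFunctor.obj) : IsIso p :=
  have := hasLiftingProperty (p := p) hp.1 hp.2
  have sq : CommSq (𝟙 A) p p (𝟙 B) := ⟨by simp⟩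
  ⟨sq.lift, sq.fac_left, sq.fac_right⟩

lemma trivialFibrations_of_obj_surjective {E D : Cat.{v, u}} (p : E ⟶ D)
    [p.toFunctor.IsEquivalence] (hp : Function.Surjective p.toFunctor.obj) :
    trivialFibrations Cat.{v, u} p :=
  ⟨fun _ _ _ hi => hasLiftingProperty hi.1 hp, ‹p.toFunctor.IsEquivalence›⟩

lemma trivialFibrations_id (X : Cat.{v, u}) : trivialFibrations Cat.{v, u} (𝟙 X) :=
  have := isEquivalence_of_isIso (𝟙 X)
  trivialFibrations_of_obj_surjective _ Function.surjective_id

lemma isCofibrant (X : Cat.{u, u}) : IsCofibrant X := by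
  have e : ⊥_ Cat.{u, u} ⟶ Cat.of (Discrete PEmpty.{u + 1}) := initial.to _
  exact ⟨fun x => (e.toFunctor.obj x).as.elim⟩

end TrivialFibrations

section Invariance

lemma isGroupoid_terminal : IsGroupoid (⊤_ Cat.{u, u} : Cat.{u, u}) :=
  (isGroupoid_iff_of_iso discretePUnitIso).1 (inferInstanceAs (IsGroupoid (Discrete PUnit)))

lemma isGroupoid_iff_of_trivialFibrations {A B : Cat.{v, u}} {p : A ⟶ B}
    (hp : trivialFibrations Cat.{v, u} p) : IsGroupoid A ↔ IsGroupoid B :=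
  have : p.toFunctor.IsEquivalence := hp.2
  isGroupoid_iff_of_isEquivalence p.toFunctor

lemma IsSphere.isGroupoid {n : ℕ} {X : Cat.{u, u}} (h : IsSphere n X) : IsGroupoid X := by
  cases n with
  | zero =>
    obtain ⟨e⟩ := h
    exact (isGroupoid_iff_of_iso (e ≪≫ (discreteIsoCoprod Equiv.ulift).symm)).2
      (inferInstanceAs (IsGroupoid (Discrete (ULift.{u} Bool))))
  | succ n =>
    obtain ⟨S, hS, S', A, B, f, g, inl, inr, pS, pA, pB, -, -, -, hpS, hpA, hpB, -, -, sq⟩ := h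
    exact isGroupoid_of_isPushout sq
      ((isGroupoid_iff_of_trivialFibrations hpS).2 hS.isGroupoid)
      ((isGroupoid_iff_of_trivialFibrations hpB).2 isGroupoid_terminal)
      ((isGroupoid_iff_of_trivialFibrations hpA).2 isGroupoid_terminal)

lemma IsCWComplex.isGroupoid {n : ℕ} {X : Cat.{u, u}} (h : IsCWComplex n X) : IsGroupoid X := by
  induction n generalizing X with
  | zero =>
    obtain ⟨-, I, ⟨e⟩⟩ := h
    exact (isGroupoid_iff_of_iso e).2 (isGroupoid_sigma fun _ => isGroupoid_terminal)
  | succ n ih =>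
    obtain ⟨I, S, Y, f, hS, hY, -, Y', g, p, inl, inr, -, hp, -, sq⟩ := h
    exact isGroupoid_of_isPushout sq (isGroupoid_sigma fun i => (hS i).isGroupoid) (ih hY)
      ((isGroupoid_iff_of_trivialFibrations hp).2 (isGroupoid_sigma fun _ => isGroupoid_terminal))

lemma WeaklyEquivalent.isGroupoid_iff {X Z : Cat.{v, u}} (h : WeaklyEquivalent X Z) :
    IsGroupoid X ↔ IsGroupoid Z := by
  induction h with
  | rel A B h =>
    obtain ⟨F, hF⟩ := h
    have : F.toFunctor.IsEquivalence := hF.mem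
    exact isGroupoid_iff_of_isEquivalence F.toFunctor
  | refl => rfl
  | symm _ _ _ ih => exact ih.symm
  | trans _ _ _ _ _ ih₁ ih₂ => exact ih₁.trans ih₂

end Invariance

/-- The free-living isomorphism `WalkingIso`, with arrows in the universe of its objects. -/
def Interval : Cat.{u, u} := codiscrete.obj (ULift.{u} Bool)

namespace Interval

variable {T U : Cat.{u, u}}

/-- Functors out of the interval classify isomorphisms. -/
def homEquiv (T : Cat.{u, u}) : (Interval ⟶ T) ≃ Σ a b : T, a ≅ b :=
  Equiv.trans
    { toFun F := ULiftHom.up ⋙ F.toFunctor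
      invFun F := (ULiftHom.down ⋙ F).toCatHom
      left_inv _ := rfl
      right_inv _ := rfl }
    WalkingIso.equiv

/-- The functor out of the interval classifying an isomorphism. -/
def ofIso {a b : T} (e : a ≅ b) : Interval ⟶ T := (homEquiv T).symm ⟨a, b, e⟩

lemma ofIso_comp {a b : T} (e : a ≅ b) (F : T ⟶ U) :
    ofIso e ≫ F = ofIso (F.toFunctor.mapIso e) :=
  (homEquiv U).injective rfl

lemma ofIso_injective {a b : T} {e e' : a ≅ b} (h : ofIso e = ofIso e') : e = e' := by
  simpa using (homEquiv T).symm.injective h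

/-- The interval has two objects. -/
def equivBool : Interval.{u} ≃ Bool :=
  (ULiftHom.objEquiv.{u, u}.symm : Interval ≃ WalkingIso).trans WalkingIso.equivBool

instance (x y : Interval.{u}) : Unique (x ⟶ y) where
  default := ⟨()⟩
  uniq _ := rfl

lemma terminal_from_obj_surjective :
    Function.Surjective (terminal.from Interval.{u}).toFunctor.obj :=
  fun _ => ⟨equivBool.symm false, Subsingleton.elim _ _⟩

instance : (terminal.from Interval.{u}).toFunctor.IsEquivalence where
  faithful := ⟨fun _ => Subsingleton.elim _ _⟩
  full := ⟨fun _ => ⟨default, Subsingleton.elim _ _⟩⟩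
  essSurj := Functor.essSurj_of_surj terminal_from_obj_surjective

lemma trivialFibrations_terminal_from : trivialFibrations Cat (terminal.from Interval.{u}) :=
  trivialFibrations_of_obj_surjective _ terminal_from_obj_surjective

lemma isSphere_vertices : IsSphere 0 (Cat.of (Discrete Interval.{u})) :=
  ⟨discreteIsoCoprod equivBool⟩

end Interval

section Circle

lemma codiagonal_obj_injective {A B : Cat.{u, u}} {f : A ⟶ B}
    (hf : Function.Surjective f.toFunctor.obj) :
    Function.Injective (pushout.codiagonal f).toFunctor.obj :=
  Function.LeftInverse.injective <| Function.RightInverse.leftInverse_of_surjective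
    (fun x => congrArg (fun F => F.toFunctor.obj x) (pushout.inl_codiagonal f))
    (obj_surjective_of_isPushout (IsPushout.of_hasPushout f f) hf)

/-- The circle: two copies of the interval glued at their ends. -/
noncomputable abbrev Circle : Cat.{u, u} := pushout.codiagonalObj (vertices Interval)

namespace Circle

/-- The projection of the circle to the interval which identifies its two arcs. -/
noncomputable abbrev fold : Circle.{u} ⟶ Interval := pushout.codiagonal (vertices Interval)

lemma isSphere : IsSphere 1 Circle.{u} :=
  ⟨_, Interval.isSphere_vertices, _, _, _, _, _, _, _, 𝟙 _, _, _, isCofibrant _,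
    ⟨(vertices_bijective _).1⟩, ⟨(vertices_bijective _).1⟩,
    trivialFibrations_id _,
    Interval.trivialFibrations_terminal_from, Interval.trivialFibrations_terminal_from,
    terminal.hom_ext _ _, terminal.hom_ext _ _, IsPushout.of_hasPushout _ _⟩

variable {T T' : Cat.{u, u}} {a b : T}

/-- The functor out of the circle classifying two parallel isomorphisms. -/
noncomputable def ofIsos (e e' : a ≅ b) : Circle ⟶ T :=
  pushout.desc (Interval.ofIso e) (Interval.ofIso e') (vertices_comp_eq_iff.2 rfl)

lemma inl_ofIsos (e e' : a ≅ b) : pushout.inl _ _ ≫ ofIsos e e' = Interval.ofIso e :=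
  pushout.inl_desc _ _ _

lemma inr_ofIsos (e e' : a ≅ b) : pushout.inr _ _ ≫ ofIsos e e' = Interval.ofIso e' :=
  pushout.inr_desc _ _ _

lemma ofIsos_comp (e e' : a ≅ b) (F : T ⟶ T') :
    ofIsos e e' ≫ F = ofIsos (F.toFunctor.mapIso e) (F.toFunctor.mapIso e') := by
  apply pushout.hom_ext
  · rw [reassoc_of% inl_ofIsos, inl_ofIsos, Interval.ofIso_comp]
  · rw [reassoc_of% inr_ofIsos, inr_ofIsos, Interval.ofIso_comp]

lemma ofIsos_self (e : a ≅ b) : ofIsos e e = fold ≫ Interval.ofIso e := by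
  apply pushout.hom_ext
  · rw [inl_ofIsos, ← Category.assoc, pushout.inl_codiagonal, Category.id_comp]
  · rw [inr_ofIsos, ← Category.assoc, pushout.inr_codiagonal, Category.id_comp]

lemma eq_of_ofIsos_eq_fold_comp {e e' : a ≅ b} {F : Interval ⟶ T} (h : ofIsos e e' = fold ≫ F) :
    e = e' := by
  have hl := pushout.inl _ _ ≫= h
  have hr := pushout.inr _ _ ≫= h
  rw [inl_ofIsos, ← Category.assoc, pushout.inl_codiagonal, Category.id_comp] at hl
  rw [inr_ofIsos, ← Category.assoc, pushout.inr_codiagonal, Category.id_comp] at hr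
  exact Interval.ofIso_injective (hl.trans hr.symm)

end Circle

end Circle

section Cells

lemma isCWComplex_of_isPushout {n : ℕ} {I : Type u} {S : I → Cat.{u, u}} {Y W : Cat.{u, u}}
    {g : ∀ i, S i ⟶ Interval} (hS : ∀ i, IsSphere n (S i))
    (hg : ∀ i, Function.Injective (g i).toFunctor.obj) (hY : IsCWComplex n Y)
    {f : ∐ S ⟶ Y} {inl : Y ⟶ W} {inr : (∐ fun _ : I => Interval) ⟶ W}
    (sq : IsPushout f (Limits.Sigma.map g) inl inr) : IsCWComplex (n + 1) W :=
  ⟨I, S, Y, f, hS, hY, isCofibrant _, _, _,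
    Limits.Sigma.map fun _ => terminal.from _, inl, inr, ⟨sigma_map_obj_injective _ hg⟩,
    trivialFibrations_of_obj_surjective _
      (sigma_map_obj_surjective _ fun _ => Interval.terminal_from_obj_surjective),
    Limits.Sigma.hom_ext _ _ fun i => by
      rw [Limits.Sigma.ι_map_assoc, Limits.Sigma.ι_map, Limits.Sigma.ι_map, ← Category.assoc,
        terminal.comp_from],
    sq⟩

end Cells

section FullFunctors

lemma existsUnique_comp_eq_of_full {Y X T : Cat.{v, u}} {q : Y ⟶ X} [q.toFunctor.Full]
    (hq : Function.Bijective q.toFunctor.obj) (H : Y ⟶ T)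
    (hH : ∀ ⦃a b : Y⦄ (p p' : a ⟶ b), q.toFunctor.map p = q.toFunctor.map p' →
      H.toFunctor.map p = H.toFunctor.map p') : ∃! d : X ⟶ T, q ≫ d = H := by
  -- `X` is the quotient of `Y` by the kernel of `q`.
  let Q : Cat.{v, u} := Cat.of (CategoryTheory.Quotient q.toFunctor.homRel)
  let π : Y ⟶ Q := (CategoryTheory.Quotient.functor q.toFunctor.homRel).toCatHom
  obtain ⟨H', hH'⟩ : ∃ H' : Q ⟶ T, π ≫ H' = H :=
    ⟨(CategoryTheory.Quotient.lift q.toFunctor.homRel H.toFunctor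
      fun _ _ p p' h => hH p p' h).toCatHom, rfl⟩
  have : Epi π :=
    ⟨fun F G h => Cat.Hom.ext
      (CategoryTheory.Quotient.lift_unique' _ _ _ (congrArg Cat.Hom.toFunctor h))⟩
  obtain ⟨e, he, hπ⟩ : ∃ e : Q ⟶ X, IsIso e ∧ π ≫ e = q := by
    let e : Q ⟶ X :=
      (CategoryTheory.Quotient.lift q.toFunctor.homRel q.toFunctor fun _ _ _ _ h => h).toCatHom
    have : e.toFunctor.Full :=
      inferInstanceAs (CategoryTheory.Quotient.lift q.toFunctor.homRel q.toFunctor _).Full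
    have : e.toFunctor.Faithful :=
      inferInstanceAs (CategoryTheory.Quotient.lift q.toFunctor.homRel q.toFunctor _).Faithful
    exact ⟨e, isIso_of_obj_bijective e (hq.comp (CategoryTheory.Quotient.equiv _).bijective), rfl⟩
  rw [← hπ]
  exact ⟨inv e ≫ H', by simp [hH'], fun d hd => by
    rw [IsIso.eq_inv_comp, ← cancel_epi π, hH', ← hd, Category.assoc]⟩

end FullFunctors

section SmallObject

open SmallObject

variable {Y X : Cat.{u, u}}

lemma full_of_interval_lift {q : Y ⟶ X} [IsGroupoid X]
    (hq : Function.Injective q.toFunctor.obj)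
    (h : ∀ E : Interval ⟶ X, ∃ l : Interval ⟶ Y, l ≫ q = E) : q.toFunctor.Full where
  map_surjective {y y'} m := by
    obtain ⟨l, hl⟩ := h (Interval.ofIso (asIso m))
    obtain ⟨⟨a, b, e⟩, rfl⟩ := (Interval.homEquiv Y).symm.surjective l
    replace hl : (⟨_, _, q.toFunctor.mapIso e⟩ : Σ x x' : X, x ≅ x') = ⟨_, _, asIso m⟩ :=
      (Interval.homEquiv X).symm.injective ((Interval.ofIso_comp e q).symm.trans hl)
    simp only [Sigma.mk.injEq] at hl
    obtain ⟨ha, hb⟩ := hl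
    obtain rfl := hq ha
    simp only [heq_eq_eq, Sigma.mk.injEq] at hb
    obtain ⟨hb, he⟩ := hb
    obtain rfl := hq hb
    exact ⟨e.hom, congrArg Iso.hom (eq_of_heq he)⟩

/-- The result of attaching to the objects of `X` one interval for each isomorphism of `X`: the
free groupoid on the graph of isomorphisms of `X`. -/
noncomputable abbrev oneSkeleton (X : Cat.{u, u}) : Cat.{u, u} :=
  functorObj (fun _ : Unit => vertices Interval) (vertices X)

/-- The projection to `X` of its 1-skeleton, sending each attached interval to the isomorphism it
is labelled by. -/
noncomputable abbrev oneSkeletonProj (X : Cat.{u, u}) : oneSkeleton X ⟶ X :=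
  πFunctorObj (fun _ : Unit => vertices Interval) (vertices X)

lemma isCWComplex_discrete (X : Cat.{u, u}) : IsCWComplex 0 (Cat.of (Discrete X)) :=
  ⟨isCofibrant _, X, ⟨discreteIsoCoproduct X⟩⟩

lemma isCWComplex_oneSkeleton (X : Cat.{u, u}) : IsCWComplex 1 (oneSkeleton X) :=
  isCWComplex_of_isPushout (fun _ => Interval.isSphere_vertices)
    (fun _ => (vertices_bijective _).1) (isCWComplex_discrete X)
    (functorObj_isPushout (fun _ : Unit => vertices Interval) (vertices X))

lemma oneSkeletonProj_bijective (X : Cat.{u, u}) :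
    Function.Bijective (oneSkeletonProj X).toFunctor.obj := by
  have h : (oneSkeletonProj X).toFunctor.obj ∘
      (ιFunctorObj (fun _ : Unit => vertices Interval) (vertices X)).toFunctor.obj =
      (vertices X).toFunctor.obj :=
    congrArg (fun F : _ ⟶ X => F.toFunctor.obj)
      (ιFunctorObj_πFunctorObj (fun _ : Unit => vertices Interval) (vertices X))
  have hι := obj_surjective_of_isPushout
    (functorObj_isPushout (fun _ : Unit => vertices Interval) (vertices X))
    (sigma_map_obj_surjective _ fun _ => (vertices_bijective _).2)
  have hb := vertices_bijective X
  rw [← h] at hb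
  exact ⟨hb.1.of_comp_right hι, hb.2.of_comp⟩

lemma oneSkeletonProj_full (X : Cat.{u, u}) [IsGroupoid X] :
    (oneSkeletonProj X).toFunctor.Full := by
  refine full_of_interval_lift (oneSkeletonProj_bijective X).1 fun E => ?_
  let t : Cat.of (Discrete Interval) ⟶ Cat.of (Discrete X) :=
    (Discrete.functor fun a => Discrete.mk (E.toFunctor.obj a)).toCatHom
  have w : t ≫ vertices X = vertices Interval ≫ E :=
    have : IsDiscrete (Cat.of (Discrete Interval)) := Discrete.isDiscrete Interval
    hom_ext_of_isDiscrete fun _ => rfl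
  obtain ⟨l, -, hl⟩ := ιFunctorObj_extension (fun _ : Unit => vertices Interval) (i := ()) t E ⟨w⟩
  exact ⟨l, hl⟩

lemma map_eq_of_functorObjTop_comp_eq [IsGroupoid Y] {q : Y ⟶ X} {T : Cat.{u, u}} {F : Y ⟶ T}
    {G : ∐ functorObjTgtFamily (fun _ : Unit => Circle.fold) q ⟶ T}
    (hF : functorObjTop (fun _ : Unit => Circle.fold) q ≫ F =
      functorObjLeft (fun _ : Unit => Circle.fold) q ≫ G)
    {a b : Y} {p p' : a ⟶ b} (h : q.toFunctor.map p = q.toFunctor.map p') :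
    F.toFunctor.map p = F.toFunctor.map p' := by
  let cell : FunctorObjIndex (fun _ : Unit => Circle.fold) q :=
    { i := ()
      t := Circle.ofIsos (asIso p) (asIso p')
      b := Interval.ofIso (q.toFunctor.mapIso (asIso p))
      w := by
        have : q.toFunctor.mapIso (asIso p') = q.toFunctor.mapIso (asIso p) := Iso.ext h.symm
        rw [Circle.ofIsos_comp, this, Circle.ofIsos_self] }
  have glue := Limits.Sigma.ι _ cell ≫= hF
  rw [Limits.Sigma.ι_desc_assoc, Limits.Sigma.ι_map_assoc, Circle.ofIsos_comp] at glue
  exact congrArg Iso.hom (Circle.eq_of_ofIsos_eq_fold_comp glue)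

lemma isPushout_of_full_of_bijective [IsGroupoid Y] (q : Y ⟶ X) [q.toFunctor.Full]
    (hq : Function.Bijective q.toFunctor.obj) :
    IsPushout (functorObjTop (fun _ : Unit => Circle.fold) q)
      (functorObjLeft (fun _ : Unit => Circle.fold) q) q
      (π'FunctorObj (fun _ : Unit => Circle.fold) q) := by
  have comm : CommSq (functorObjTop (fun _ : Unit => Circle.fold) q)
      (functorObjLeft (fun _ : Unit => Circle.fold) q) q
      (π'FunctorObj (fun _ : Unit => Circle.fold) q) :=
    ⟨Limits.Sigma.hom_ext _ _ fun x => by simp⟩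
  have existsUnique_desc (s : PushoutCocone (functorObjTop (fun _ : Unit => Circle.fold) q)
      (functorObjLeft (fun _ : Unit => Circle.fold) q)) :=
    existsUnique_comp_eq_of_full hq s.inl fun _ _ _ _ h =>
      map_eq_of_functorObjTop_comp_eq s.condition h
  choose desc fac uniq using existsUnique_desc
  refine ⟨comm, ⟨PushoutCocone.IsColimit.mk _ desc fac (fun s => ?_) fun s m hm _ => uniq s m hm⟩⟩
  have : Epi (functorObjLeft (fun _ : Unit => Circle.fold) q) := Limits.Sigma.map_epi _
  rw [← cancel_epi (functorObjLeft (fun _ : Unit => Circle.fold) q), ← comm.w_assoc, fac,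
    s.condition]

lemma isCWComplex_two (X : Cat.{u, u}) [IsGroupoid X] : IsCWComplex 2 X :=
  have := oneSkeletonProj_full X
  have := (isCWComplex_oneSkeleton X).isGroupoid
  isCWComplex_of_isPushout (fun _ => Circle.isSphere)
    (fun _ => codiagonal_obj_injective (vertices_bijective _).2) (isCWComplex_oneSkeleton X)
    (isPushout_of_full_of_bijective (oneSkeletonProj X) (oneSkeletonProj_bijective X))

end SmallObject

end FormalCW

theorem mainTheorem5 (X : Cat.{u, u}) :
    (FormalCW.IsCWComplex 2 X ↔ IsGroupoid X) ∧
    ((∃ Z : Cat.{u, u}, FormalCW.IsCWComplex 2 Z ∧ FormalCW.WeaklyEquivalent X Z) ↔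
      IsGroupoid X) :=
  ⟨⟨fun h => h.isGroupoid, fun _ => FormalCW.isCWComplex_two X⟩,
    ⟨fun ⟨_, hZ, h⟩ => h.isGroupoid_iff.2 hZ.isGroupoid,
      fun _ => ⟨X, FormalCW.isCWComplex_two X, Relation.EqvGen.refl X⟩⟩⟩
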